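/- A complex Zinbiel algebra is a complex vector space $A$ with a bilinear product $\circ : A\times A\to A$ satisfying $(u\circ v)\circ w = u\circ(v\circ w)+u\circ(w\circ v)$ for all $u,v,w\in A$. For $w\in A$ let $\mathrm{ad}_w : A\to A$, $\mathrm{ad}_w(u)=u\circ w-w\circ u$; the map $\mathrm{ad}_w$ is called the inner derivation of $A$ associated with $w$ (it is not required to satisfy the Leibniz rule), and $\mathrm{Inn}(A)=\{\mathrm{ad}_w : w\in A\}$, a linear subspace of $\mathrm{End}_{\mathbb C}(A)$. Then: 1. If $\dim A=2$, then $\dim \mathrm{Inn}(A)=0$. 2. If $\dim A=3$, then $0\le\dim \mathrm{Inn}(A)\le 2$, and both values $0$ and $2$ occur for suitable three-dimensional complex Zinbiel algebras. 3. If $\dim A=4$, then $0\le\dim \mathrm{Inn}(A)\le 3$, and both values $0$ and $3$ occur for suitable four-dimensional complex Zinbiel algebras. -/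

import Mathlib

/-- A structure of (right) Zinbiel algebra on a complex vector space `A`: a bilinear product `∘`
with `(u ∘ v) ∘ w = u ∘ (v ∘ w) + u ∘ (w ∘ v)`. -/
structure ZinbielStructure (A : Type*) [AddCommGroup A] [Module ℂ A] where
  /-- The bilinear product; `mul u v` is `u ∘ v`. -/
  mul : A →ₗ[ℂ] A →ₗ[ℂ] A
  /-- The Zinbiel identity. -/
  zinbiel : ∀ u v w : A, mul (mul u v) w = mul u (mul v w) + mul u (mul w v)

namespace ZinbielStructure

variable {A : Type*} [AddCommGroup A] [Module ℂ A]

/-- The linear map `w ↦ ad_w`, where `ad_w u = u ∘ w - w ∘ u`. -/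
def ad (Z : ZinbielStructure A) : A →ₗ[ℂ] Module.End ℂ A :=
  Z.mul.flip - Z.mul

theorem ad_apply (Z : ZinbielStructure A) (w u : A) :
    Z.ad w u = Z.mul u w - Z.mul w u := rfl

/-- The space `Inn(A) = {ad_w | w ∈ A}` of inner derivations, a subspace of `End(A)`. -/
def inn (Z : ZinbielStructure A) : Submodule ℂ (Module.End ℂ A) :=
  LinearMap.range Z.ad

theorem mem_inn (Z : ZinbielStructure A) (D : Module.End ℂ A) :
    D ∈ Z.inn ↔ ∃ w : A, Z.ad w = D := Iff.rfl

end ZinbielStructure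

/-! Since `Inn(A)` is the range of `ad`, its dimension is the codimension of `ker ad`. This kernel
contains the two-sided annihilator, nonzero by two Engel-type arguments
(`exists_ne_zero_mul_eq_zero`): first for the algebra generated by left multiplications, whose
products are traceless, then for right multiplications, which are closed under composition. So the
rank is below `dim A`; it is never 1 because `ad` is alternating, which settles dimension 2. The
zero product and a truncated integration algebra attain the extremes. -/

section NilpotentEndomorphisms

open Polynomial

variable {K V : Type*} [Field K] [AddCommGroup V] [Module K V]

/-- A non-nilpotent endomorphism of a finite-dimensional space has a nonzero idempotent among its
polynomial expressions without constant and linear term. -/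
theorem exists_isIdempotentElem_of_not_isNilpotent [FiniteDimensional K V] (f : Module.End K V)
    (hf : ¬ IsNilpotent f) :
    ∃ r : K[X], IsIdempotentElem (f * f * aeval f r) ∧ f * f * aeval f r ≠ 0 := by
  have hint : IsIntegral K f := Algebra.IsIntegral.isIntegral f
  obtain ⟨q, hq, hXq⟩ :=
    (minpoly K f).exists_eq_pow_rootMultiplicity_mul_and_not_dvd (minpoly.ne_zero hint) 0
  set m := (minpoly K f).rootMultiplicity 0
  rw [C_0, sub_zero] at hq hXq
  -- Bézout gives the Fitting projection onto the invertible part of `f`; the exponent `m + 2`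
  -- leaves a factor `f * f`.
  have hcop : IsCoprime ((X : K[X]) ^ (m + 2)) q :=
    ((prime_X.coprime_iff_not_dvd).2 hXq).pow_left
  obtain ⟨a, b, hab⟩ := hcop
  have hkill : aeval f (X ^ m * q) = 0 := by rw [← hq, minpoly.aeval]
  have he : f * f * aeval f (a * X ^ m) = aeval f (a * X ^ (m + 2)) := by
    rw [show a * X ^ (m + 2) = X * X * (a * X ^ m) by ring, map_mul _ (X * X),
      map_mul _ X, aeval_X]
  refine ⟨a * X ^ m, ?_, ?_⟩
  · rw [he, IsIdempotentElem, ← map_mul, ← sub_eq_zero, ← map_sub,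
      show a * X ^ (m + 2) * (a * X ^ (m + 2)) - a * X ^ (m + 2)
        = -(a * b * X ^ 2) * (X ^ m * q) by
          linear_combination (a * X ^ (m + 2)) * hab, map_mul, hkill, mul_zero]
  · rw [he]
    intro h0
    have h1 : aeval f (b * q) = 1 := by
      have := congrArg (aeval f) hab
      rwa [map_add, h0, zero_add, map_one] at this
    refine hf ⟨m, ?_⟩
    calc f ^ m = aeval f (b * q) * f ^ m := by rw [h1, one_mul]
      _ = aeval f (b * (X ^ m * q)) := by
        rw [show b * (X ^ m * q) = b * q * X ^ m by ring, map_mul _ (b * q), map_pow,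
          aeval_X]
      _ = 0 := by rw [map_mul, hkill, mul_zero]

/-- The idempotent is a combination of powers `f ^ (k + 2)`, hence traceless, hence zero in
characteristic 0. The trace of `f` itself is not needed. -/
theorem isNilpotent_of_trace_pow_eq_zero [CharZero K] [FiniteDimensional K V]
    (f : Module.End K V) (hf : ∀ k, LinearMap.trace K V (f ^ (k + 2)) = 0) : IsNilpotent f := by
  by_contra hnil
  obtain ⟨r, hid, hne⟩ := exists_isIdempotentElem_of_not_isNilpotent f hnil
  refine hne (LinearMap.IsIdempotentElem.eq_zero_of_trace_eq_zero hid ?_)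
  rw [aeval_eq_sum_range, Finset.mul_sum, map_sum]
  refine Finset.sum_eq_zero fun k _ => ?_
  rw [mul_smul_comm, map_smul, ← pow_two, ← pow_add, add_comm, hf, smul_zero]

theorem mul_aeval_mem_of_mul_mem (S : Submodule K (Module.End K V))
    (hS : ∀ f ∈ S, ∀ g ∈ S, f * g ∈ S) {f : Module.End K V} (hf : f ∈ S) (r : K[X]) :
    f * aeval f r ∈ S := by
  have hpow (k : ℕ) : f * f ^ k ∈ S := by
    induction k with
    | zero => simpa using hf
    | succ k ih => rw [pow_succ']; exact hS _ hf _ ih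
  rw [aeval_eq_sum_range, Finset.mul_sum]
  refine S.sum_mem fun k _ => ?_
  rw [mul_smul_comm]
  exact S.smul_mem _ (hpow k)

attribute [local instance] LieRing.ofAssociativeRing

/-- A multiplicatively closed space of nilpotent endomorphisms has a common null vector in every
nonzero invariant subspace. -/
theorem exists_ne_zero_forall_apply_eq_zero [FiniteDimensional K V]
    (S : Submodule K (Module.End K V)) (hS : ∀ f ∈ S, ∀ g ∈ S, f * g ∈ S)
    (hnil : ∀ f ∈ S, IsNilpotent f) (P : Submodule K V) (hP : P ≠ ⊥)
    (hinv : ∀ f ∈ S, ∀ v ∈ P, f v ∈ P) :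
    ∃ v ∈ P, v ≠ 0 ∧ ∀ f ∈ S, f v = 0 := by
  let L : LieSubalgebra K (Module.End K V) :=
    { S with lie_mem' := fun {f g} hf hg => S.sub_mem (hS f hf g hg) (hS g hg f hf) }
  let N : LieSubmodule K L V := { P with lie_mem := fun {f v} hv => hinv f f.2 v hv }
  have : LieModule.IsNilpotent L V :=
    (LieModule.isNilpotent_iff_forall (R := K)).2 fun f => hnil f f.2
  have : Nontrivial N := (Submodule.nontrivial_iff_ne_bot (p := P)).2 hP
  have : LieModule.IsNilpotent L N :=
    Function.Injective.lieModuleIsNilpotent (R := K) (f := (LieHom.id : L →ₗ⁅K⁆ L))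
      (g := (N : Submodule K V).subtype) (fun _ _ => rfl) Subtype.val_injective
  have := LieModule.nontrivial_max_triv_of_isNilpotent K L N
  obtain ⟨⟨v, hv⟩, hne⟩ := exists_ne (0 : LieModule.maxTrivSubmodule K L N)
  refine ⟨v, v.2, fun h => hne (Subtype.ext (Subtype.ext h)), fun f hf => ?_⟩
  exact congrArg Subtype.val ((LieModule.mem_maxTrivSubmodule K L N v).1 hv ⟨f, hf⟩)

end NilpotentEndomorphisms

/-! ### Left multiplications: vanishing traces -/

namespace ZinbielStructure

variable {A : Type*} [AddCommGroup A] [Module ℂ A] (Z : ZinbielStructure A)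

/-- Multiplication by `w` for the associated product `u ∘ w + w ∘ u`. -/
def symMul (w : A) : Module.End ℂ A := Z.mul w + Z.mul.flip w

theorem symMul_apply (w u : A) : Z.symMul w u = Z.mul w u + Z.mul u w := rfl

theorem mul_mul_eq_mul_symMul (u v : A) : Z.mul (Z.mul u v) = Z.mul u * Z.symMul v := by
  ext w
  simp [Z.zinbiel, symMul_apply]

theorem symMul_mul_mul (w u : A) :
    Z.symMul w * Z.mul u = Z.mul w * Z.mul u + Z.mul u * Z.symMul w := by
  ext v
  simp [Z.zinbiel, symMul_apply, add_comm]

theorem flip_mul_flip (v w : A) :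
    Z.mul.flip w * Z.mul.flip v = Z.mul.flip (Z.symMul v w) := by
  ext u
  simp [Z.zinbiel, symMul_apply]

/-- The composite of the left multiplications by the entries of a list. -/
def leftProd (l : List A) : Module.End ℂ A := (l.map Z.mul).prod

theorem leftProd_cons (u : A) (l : List A) : Z.leftProd (u :: l) = Z.mul u * Z.leftProd l := by
  simp [leftProd]

theorem leftProd_append (l l' : List A) :
    Z.leftProd (l ++ l') = Z.leftProd l * Z.leftProd l' := by
  simp [leftProd]

theorem exists_leftProd_mul_symMul (v u : A) (l : List A) :
    ∃ x l', l'.length = l.length ∧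
      Z.leftProd (u :: l) * Z.symMul v = Z.leftProd (x :: l') := by
  induction l generalizing u with
  | nil => exact ⟨Z.mul u v, [], rfl, by simp [leftProd, mul_mul_eq_mul_symMul]⟩
  | cons y t ih =>
    obtain ⟨x, l', hl, h⟩ := ih y
    exact ⟨u, x :: l', by simp [hl], by rw [leftProd_cons, mul_assoc, h, ← leftProd_cons]⟩

theorem trace_leftProd_eq_zero (u v : A) (l : List A) :
    LinearMap.trace ℂ A (Z.leftProd (v :: u :: l)) = 0 := by
  induction hn : l.length generalizing u v l with
  | zero =>
    obtain rfl := List.length_eq_zero_iff.1 hn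
    have h := congrArg (LinearMap.trace ℂ A) (Z.symMul_mul_mul v u)
    rw [map_add, LinearMap.trace_mul_comm] at h
    simpa [leftProd] using h
  | succ n ih =>
    obtain ⟨y, t, rfl⟩ := List.exists_cons_of_length_eq_add_one hn
    have ht : t.length = n := by simpa using hn
    -- Cycling `symMul v` to the end, or commuting it past `mul u`, absorbs it into a neighbouring
    -- factor: both words are one letter shorter.
    obtain ⟨x, l', hl, hY⟩ := Z.exists_leftProd_mul_symMul v y t
    have h1 := ih y (Z.mul u v) t ht
    rw [leftProd_cons, mul_mul_eq_mul_symMul] at h1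
    have h2 := ih x u l' (hl.trans ht)
    rw [leftProd_cons, ← hY, ← mul_assoc, LinearMap.trace_mul_comm, ← mul_assoc,
      symMul_mul_mul, add_mul, map_add, h1, add_zero] at h2
    rwa [leftProd_cons, leftProd_cons, ← mul_assoc]

/-- The associative algebra without unit generated by the left multiplications. -/
def leftAlgebra : Submodule ℂ (Module.End ℂ A) :=
  Submodule.span ℂ {f | ∃ u l, f = Z.leftProd (u :: l)}

theorem mul_mem_leftAlgebra (u : A) : Z.mul u ∈ Z.leftAlgebra :=
  Submodule.subset_span ⟨u, [], by simp [leftProd]⟩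

theorem leftAlgebra_mul_mem {f g : Module.End ℂ A} (hf : f ∈ Z.leftAlgebra)
    (hg : g ∈ Z.leftAlgebra) : f * g ∈ Z.leftAlgebra := by
  induction hf, hg using Submodule.span_induction₂ with
  | mem_mem f g hf hg =>
    obtain ⟨u, l, rfl⟩ := hf
    obtain ⟨v, l', rfl⟩ := hg
    exact Submodule.subset_span ⟨u, l ++ v :: l', by rw [← leftProd_append, List.cons_append]⟩
  | zero_left => simp
  | zero_right => simp
  | add_left x y z _ _ _ h₁ h₂ => rw [add_mul]; exact add_mem h₁ h₂
  | add_right x y z _ _ _ h₁ h₂ => rw [mul_add]; exact add_mem h₁ h₂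
  | smul_left r x y _ _ h => rw [smul_mul_assoc]; exact Submodule.smul_mem _ _ h
  | smul_right r x y _ _ h => rw [mul_smul_comm]; exact Submodule.smul_mem _ _ h

theorem trace_mul_eq_zero_of_mem_leftAlgebra {f g : Module.End ℂ A} (hf : f ∈ Z.leftAlgebra)
    (hg : g ∈ Z.leftAlgebra) : LinearMap.trace ℂ A (f * g) = 0 := by
  induction hf, hg using Submodule.span_induction₂ with
  | mem_mem f g hf hg =>
    obtain ⟨u, l, rfl⟩ := hf
    obtain ⟨v, l', rfl⟩ := hg
    rw [← leftProd_append]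
    cases l with
    | nil => exact Z.trace_leftProd_eq_zero v u l'
    | cons y t => exact Z.trace_leftProd_eq_zero y u (t ++ v :: l')
  | zero_left => simp
  | zero_right => simp
  | add_left x y z _ _ _ h₁ h₂ => rw [add_mul, map_add, h₁, h₂, add_zero]
  | add_right x y z _ _ _ h₁ h₂ => rw [mul_add, map_add, h₁, h₂, add_zero]
  | smul_left r x y _ _ h => rw [smul_mul_assoc, map_smul, h, smul_zero]
  | smul_right r x y _ _ h => rw [mul_smul_comm, map_smul, h, smul_zero]

theorem isNilpotent_of_mem_leftAlgebra [FiniteDimensional ℂ A] {f : Module.End ℂ A}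
    (hf : f ∈ Z.leftAlgebra) : IsNilpotent f := by
  refine isNilpotent_of_trace_pow_eq_zero f fun k => ?_
  rw [pow_succ']
  refine Z.trace_mul_eq_zero_of_mem_leftAlgebra hf ?_
  induction k with
  | zero => simpa using hf
  | succ k ih => rw [pow_succ']; exact Z.leftAlgebra_mul_mem hf ih

/-! ### Right multiplications and the annihilator -/

theorem range_flip_mul_mem (f : Module.End ℂ A) (hf : f ∈ LinearMap.range Z.mul.flip)
    (g : Module.End ℂ A) (hg : g ∈ LinearMap.range Z.mul.flip) :
    f * g ∈ LinearMap.range Z.mul.flip := by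
  obtain ⟨w, rfl⟩ := hf
  obtain ⟨v, rfl⟩ := hg
  exact ⟨_, (Z.flip_mul_flip v w).symm⟩

/-- Write `R` for right multiplication and `d = c ∘ c`. Then `R c = 2 R d`, and `d` is idempotent
for the symmetrized product, so `R c = 4 (R d)² = 4 R d = 2 R c`. -/
theorem flip_eq_zero_of_isIdempotentElem (c : A) (hc : IsIdempotentElem (Z.mul.flip c)) :
    Z.mul.flip c = 0 := by
  have hcc : Z.symMul c c = (2 : ℂ) • Z.mul c c := by rw [symMul_apply, two_smul]
  have h1 : (2 : ℂ) • Z.mul.flip (Z.mul c c) = Z.mul.flip c := by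
    rw [← map_smul, ← hcc, ← flip_mul_flip, hc.eq]
  have h2 : Z.mul (Z.mul c c) c = Z.mul c c := LinearMap.congr_fun hc c
  have h3 : (2 : ℂ) • Z.mul (Z.mul c c) (Z.mul c c) = Z.mul c c := by
    rw [← h2]
    simpa [h2] using LinearMap.congr_fun h1 (Z.mul c c)
  have h4 : Z.symMul (Z.mul c c) (Z.mul c c) = Z.mul c c := by
    rw [symMul_apply, ← two_smul ℂ, h3]
  have h5 := Z.flip_mul_flip (Z.mul c c) (Z.mul c c)
  rw [h4] at h5
  have h6 : Z.mul.flip c = (2 : ℂ) • Z.mul.flip c := by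
    conv_lhs => rw [← hc.eq, ← h1, smul_mul_smul_comm, h5, mul_smul, h1]
  rw [two_smul] at h6
  simpa using h6

theorem isNilpotent_flip [FiniteDimensional ℂ A] (w : A) : IsNilpotent (Z.mul.flip w) := by
  by_contra hnil
  obtain ⟨r, hid, hne⟩ := exists_isIdempotentElem_of_not_isNilpotent _ hnil
  have hw : Z.mul.flip w ∈ LinearMap.range Z.mul.flip := ⟨w, rfl⟩
  obtain ⟨c, hc⟩ := Z.range_flip_mul_mem _ hw _
    (mul_aeval_mem_of_mul_mem _ Z.range_flip_mul_mem hw r)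
  rw [← mul_assoc] at hc
  rw [← hc] at hid hne
  exact hne (Z.flip_eq_zero_of_isIdempotentElem c hid)

/-- A nonzero finite-dimensional Zinbiel algebra has a nonzero two-sided annihilator. -/
theorem exists_ne_zero_mul_eq_zero [FiniteDimensional ℂ A] [Nontrivial A] :
    ∃ a : A, a ≠ 0 ∧ (∀ u, Z.mul u a = 0) ∧ ∀ u, Z.mul a u = 0 := by
  obtain ⟨a, -, ha, hLa⟩ := exists_ne_zero_forall_apply_eq_zero Z.leftAlgebra
    (fun _ hf _ hg => Z.leftAlgebra_mul_mem hf hg)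
    (fun _ hf => Z.isNilpotent_of_mem_leftAlgebra hf) ⊤ top_ne_bot (fun _ _ _ _ => trivial)
  let P : Submodule ℂ A := LinearMap.ker Z.mul.flip
  have hP {x : A} : x ∈ P ↔ ∀ u, Z.mul u x = 0 := by
    simp [P, LinearMap.ext_iff]
  have haP : a ∈ P := hP.2 fun u => hLa _ (Z.mul_mem_leftAlgebra u)
  obtain ⟨b, hbP, hb, hRb⟩ := exists_ne_zero_forall_apply_eq_zero (LinearMap.range Z.mul.flip)
    Z.range_flip_mul_mem (by rintro _ ⟨w, rfl⟩; exact Z.isNilpotent_flip w) P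
    (fun h => ha (by simpa [h] using haP)) (by
      rintro _ ⟨w, rfl⟩ x hx
      rw [hP] at hx ⊢
      intro u
      have h := Z.zinbiel u x w
      rw [hx u, hx w] at h
      simpa using h.symm)
  exact ⟨b, hb, hP.1 hbP, fun u => hRb _ ⟨u, rfl⟩⟩

/-! ### Rank of `ad` -/

theorem finrank_inn_add_finrank_ker [FiniteDimensional ℂ A] :
    Module.finrank ℂ Z.inn + Module.finrank ℂ (LinearMap.ker Z.ad) = Module.finrank ℂ A :=
  LinearMap.finrank_range_add_finrank_ker Z.ad

theorem finrank_inn_lt [FiniteDimensional ℂ A] [Nontrivial A] :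
    Module.finrank ℂ Z.inn < Module.finrank ℂ A := by
  obtain ⟨a, ha, h1, h2⟩ := Z.exists_ne_zero_mul_eq_zero
  have hmem : a ∈ LinearMap.ker Z.ad := by
    rw [LinearMap.mem_ker]
    ext u
    simp [ad_apply, h1, h2]
  have : Nontrivial (LinearMap.ker Z.ad) :=
    ⟨⟨a, hmem⟩, 0, fun h => ha (congrArg Subtype.val h)⟩
  have := Module.finrank_pos (R := ℂ) (M := LinearMap.ker Z.ad)
  have := Z.finrank_inn_add_finrank_ker
  omega

/-- The kernel of `ad` never has codimension one, because `ad` is alternating. -/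
theorem finrank_inn_ne_one [FiniteDimensional ℂ A] : Module.finrank ℂ Z.inn ≠ 1 := by
  intro h
  obtain ⟨⟨_, w, rfl⟩, hne, hspan⟩ := finrank_eq_one_iff'.1 h
  have hw : Z.ad w ≠ 0 := fun h0 => hne (Subtype.ext h0)
  have hmul (x : A) : ∃ c : ℂ, c • Z.ad w = Z.ad x := by
    obtain ⟨c, hc⟩ := hspan ⟨Z.ad x, x, rfl⟩
    exact ⟨c, congrArg Subtype.val hc⟩
  refine hw (LinearMap.ext fun x => ?_)
  obtain ⟨c, hc⟩ := hmul x
  -- Evaluating `ad x = c • ad w` at `w` kills the left side, and `ad w x = -ad x w`.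
  have h1 := LinearMap.congr_fun hc w
  simp only [LinearMap.smul_apply, ad_apply, sub_self, smul_zero] at h1
  rw [ad_apply, LinearMap.zero_apply, ← neg_sub, ← h1, neg_zero]

/-! ### Extremal examples -/

/-- The Zinbiel algebra with zero product. -/
def trivialStructure (A : Type*) [AddCommGroup A] [Module ℂ A] : ZinbielStructure A where
  mul := 0
  zinbiel := by simp

theorem finrank_inn_trivialStructure : Module.finrank ℂ (trivialStructure A).inn = 0 := by
  have : (trivialStructure A).ad = 0 := by
    ext w u
    simp [ad_apply, trivialStructure]
  rw [inn, this, LinearMap.range_zero, finrank_bot]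

/-- The one-generated nilpotent Zinbiel algebra on a space with coordinates `e`. -/
def nullFiliformThree (e : A ≃ₗ[ℂ] (Fin 3 → ℂ)) : ZinbielStructure A where
  mul := LinearMap.mk₂ ℂ
    -- This is `u ∘ v = ∫ u' v` in the basis `t^i / i!`, `i ≥ 1`, truncated: the coefficients are
    -- `binom(i + j - 1, j)`.
    (fun x y => e.symm ![0, e x 0 * e y 0, e x 0 * e y 1 + 2 * (e x 1 * e y 0)])
    (fun x x' y => by
      rw [← map_add]; congr 1; ext i; fin_cases i <;> simp <;> ring)
    (fun c x y => by
      rw [← map_smul]; congr 1; ext i; fin_cases i <;> simp <;> ring)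
    (fun x y y' => by
      rw [← map_add]; congr 1; ext i; fin_cases i <;> simp <;> ring)
    (fun c x y => by
      rw [← map_smul]; congr 1; ext i; fin_cases i <;> simp <;> ring)
  zinbiel u v w := by
    simp only [LinearMap.mk₂_apply, LinearEquiv.apply_symm_apply]
    rw [← map_add]; congr 1; ext i; fin_cases i <;> simp; ring

/-- The one-generated nilpotent Zinbiel algebra on a space with coordinates `e`. -/
def nullFiliformFour (e : A ≃ₗ[ℂ] (Fin 4 → ℂ)) : ZinbielStructure A where
  mul := LinearMap.mk₂ ℂ
    (fun x y => e.symm ![0, e x 0 * e y 0, e x 0 * e y 1 + 2 * (e x 1 * e y 0),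
      e x 0 * e y 2 + 3 * (e x 1 * e y 1) + 3 * (e x 2 * e y 0)])
    (fun x x' y => by
      rw [← map_add]; congr 1; ext i; fin_cases i <;> simp <;> ring)
    (fun c x y => by
      rw [← map_smul]; congr 1; ext i; fin_cases i <;> simp <;> ring)
    (fun x y y' => by
      rw [← map_add]; congr 1; ext i; fin_cases i <;> simp <;> ring)
    (fun c x y => by
      rw [← map_smul]; congr 1; ext i; fin_cases i <;> simp <;> ring)
  zinbiel u v w := by
    simp only [LinearMap.mk₂_apply, LinearEquiv.apply_symm_apply]
    rw [← map_add]; congr 1; ext i; fin_cases i <;> simp <;> ring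

theorem le_finrank_inn_of_ker_le_span [FiniteDimensional ℂ A] (a : A)
    (h : ∀ w, Z.ad w = 0 → ∃ c : ℂ, c • a = w) :
    Module.finrank ℂ A ≤ Module.finrank ℂ Z.inn + 1 := by
  have hle : LinearMap.ker Z.ad ≤ Submodule.span ℂ {a} := fun w hw =>
    Submodule.mem_span_singleton.2 (h w hw)
  have := (Submodule.finrank_mono hle).trans (finrank_span_le_card ({a} : Set A))
  rw [Set.toFinset_singleton, Finset.card_singleton] at this
  have := Z.finrank_inn_add_finrank_ker
  omega

theorem finrank_inn_nullFiliformThree (e : A ≃ₗ[ℂ] (Fin 3 → ℂ)) :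
    3 ≤ Module.finrank ℂ (nullFiliformThree e).inn + 1 := by
  have : FiniteDimensional ℂ A := e.symm.finiteDimensional
  have hA : Module.finrank ℂ A = 3 := by simpa using e.finrank_eq
  rw [← hA]
  refine le_finrank_inn_of_ker_le_span _ (e.symm (Pi.single 2 1)) fun w hw => ⟨e w 2, ?_⟩
  have key (u : A) : e ((nullFiliformThree e).ad w u) = 0 := by rw [hw]; simp
  have h0 := congrFun (key (e.symm (Pi.single 0 1))) 2
  have h1 := congrFun (key (e.symm (Pi.single 1 1))) 2
  simp [ad_apply, nullFiliformThree] at h0 h1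
  apply e.injective
  ext i
  fin_cases i <;> simp <;> grind

theorem finrank_inn_nullFiliformFour (e : A ≃ₗ[ℂ] (Fin 4 → ℂ)) :
    4 ≤ Module.finrank ℂ (nullFiliformFour e).inn + 1 := by
  have : FiniteDimensional ℂ A := e.symm.finiteDimensional
  have hA : Module.finrank ℂ A = 4 := by simpa using e.finrank_eq
  rw [← hA]
  refine le_finrank_inn_of_ker_le_span _ (e.symm (Pi.single 3 1)) fun w hw => ⟨e w 3, ?_⟩
  have key (u : A) : e ((nullFiliformFour e).ad w u) = 0 := by rw [hw]; simp
  have h0 := congrFun (key (e.symm (Pi.single 0 1))) 2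
  have h1 := congrFun (key (e.symm (Pi.single 1 1))) 2
  have h2 := congrFun (key (e.symm (Pi.single 0 1))) 3
  simp [ad_apply, nullFiliformFour] at h0 h1 h2
  apply e.injective
  ext i
  fin_cases i <;> simp <;> grind

end ZinbielStructure

theorem mainTheorem4 {A : Type*} [AddCommGroup A] [Module ℂ A] :
    (Module.finrank ℂ A = 2 →
      ∀ Z : ZinbielStructure A, Module.finrank ℂ Z.inn = 0) ∧
    (Module.finrank ℂ A = 3 →
      (∀ Z : ZinbielStructure A, 0 ≤ Module.finrank ℂ Z.inn ∧ Module.finrank ℂ Z.inn ≤ 2) ∧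
      (∃ Z : ZinbielStructure A, Module.finrank ℂ Z.inn = 0) ∧
      (∃ Z : ZinbielStructure A, Module.finrank ℂ Z.inn = 2)) ∧
    (Module.finrank ℂ A = 4 →
      (∀ Z : ZinbielStructure A, 0 ≤ Module.finrank ℂ Z.inn ∧ Module.finrank ℂ Z.inn ≤ 3) ∧
      (∃ Z : ZinbielStructure A, Module.finrank ℂ Z.inn = 0) ∧
      (∃ Z : ZinbielStructure A, Module.finrank ℂ Z.inn = 3)) := by
  have hfin {n : ℕ} (h : Module.finrank ℂ A = n + 1) :
      FiniteDimensional ℂ A ∧ Nontrivial A :=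
    ⟨.of_finrank_pos (by omega), Module.nontrivial_of_finrank_pos (R := ℂ) (by omega)⟩
  refine ⟨fun h Z => ?_, fun h => ?_, fun h => ?_⟩ <;> obtain ⟨_, _⟩ := hfin h
  · have := Z.finrank_inn_lt
    have := Z.finrank_inn_ne_one
    omega
  · have hle (Z : ZinbielStructure A) : Module.finrank ℂ Z.inn ≤ 2 := by
      have := Z.finrank_inn_lt
      omega
    let e : A ≃ₗ[ℂ] (Fin 3 → ℂ) := LinearEquiv.ofFinrankEq _ _ (by simpa using h)
    exact ⟨fun Z => ⟨Nat.zero_le _, hle Z⟩, ⟨_, ZinbielStructure.finrank_inn_trivialStructure⟩,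
      .nullFiliformThree e, le_antisymm (hle _)
        (by have := ZinbielStructure.finrank_inn_nullFiliformThree e; omega)⟩
  · have hle (Z : ZinbielStructure A) : Module.finrank ℂ Z.inn ≤ 3 := by
      have := Z.finrank_inn_lt
      omega
    let e : A ≃ₗ[ℂ] (Fin 4 → ℂ) := LinearEquiv.ofFinrankEq _ _ (by simpa using h)
    exact ⟨fun Z => ⟨Nat.zero_le _, hle Z⟩, ⟨_, ZinbielStructure.finrank_inn_trivialStructure⟩,
      .nullFiliformFour e, le_antisymm (hle _)
        (by have := ZinbielStructure.finrank_inn_nullFiliformFour e; omega)⟩
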